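/- A configuration over a finite set of colours $Q$ is a map $\mathbb Z^2\to Q$, seen as a structure with universe $\mathbb Z^2$, the four unary functions North, South, East, West (moving a cell by one unit) and a unary predicate $P_c$ for each colour $c\in Q$. A set of configurations is MSO-definable if it is the set of models of a closed monadic second-order formula over this signature (first-order variables range over $\mathbb Z^2$, second-order variables over all subsets of $\mathbb Z^2$). A finite pattern is a map $P:D\to Q$ with $D\subset\mathbb Z^2$ finite; it occurs in $C$ if for some $z_0\in\mathbb Z^2$ we have $C(z_0+z)=P(z)$ for all $z\in D$. A subshift is a set of configurations of the form $X_{\mathcal G}=\{C : \text{no pattern of } \mathcal G \text{ occurs in } C\}$ for some set $\mathcal G$ of finite patterns. The forbidden language of a subshift $X$ is the set $\mathcal F$ of all finite patterns that occur in no configuration of $X$. A set $E\subseteq\mathbb N$ is arithmetical if $E$ can be defined by a finite alternating prefix of quantifiers over $\mathbb N$ in front of a recursive relation. **Theorem.** Let $E\subseteq\mathbb N$ be an arithmetical set. Then there are a finite set of colours $Q$ and an MSO-definable subshift $X\subseteq Q^{\mathbb Z^2}$, with forbidden language $\mathcal F$, such that $E$ is many-one reducible to $\mathcal F$: there is a computable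 function $f$ from $\mathbb N$ to finite patterns over $Q$ (each given as a finite list of coloured cells) such that for all $m\in\mathbb N$, $m\in E$ if and only if $f(m)\in\mathcal F$. -/

import Mathlib

open SymbolicDynamics.FullShift

/-! ### Monadic second-order logic over configurations of the plane -/

/-- A configuration of the plane with colours in `Q`. -/
abbrev Configuration (Q : Type) : Type := ℤ × ℤ → Q

/-- The four unary function symbols of the signature. -/
inductive Direction : Type
  | north
  | south
  | east
  | west

/-- The interpretation of the four function symbols on the cells of the plane. -/
def Direction.move : Direction → ℤ × ℤ → ℤ × ℤ
  | .north, z => (z.1, z.2 + 1)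
  | .south, z => (z.1, z.2 - 1)
  | .east, z => (z.1 + 1, z.2)
  | .west, z => (z.1 - 1, z.2)

/-- Terms: first-order variables (named by natural numbers), or a function symbol applied to a
term. -/
inductive MSOTerm : Type
  | var (x : ℕ)
  | app (d : Direction) (t : MSOTerm)

/-- The unique variable that occurs in a term. -/
def MSOTerm.variable : MSOTerm → ℕ
  | .var x => x
  | .app _ t => t.variable

/-- The value of a term under an assignment of cells to the first-order variables. -/
def MSOTerm.value (v : ℕ → ℤ × ℤ) : MSOTerm → ℤ × ℤ
  | .var x => v x
  | .app d t => d.move (t.value v)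

/-- Monadic second-order formulas over the colour set `Q`. First-order and second-order variables
are two separate sorts, both named by natural numbers. -/
inductive MSOFormula (Q : Type) : Type
  | eq (s t : MSOTerm)
  | mem (X : ℕ) (t : MSOTerm)
  | color (c : Q) (t : MSOTerm)
  | not (φ : MSOFormula Q)
  | and (φ ψ : MSOFormula Q)
  | or (φ ψ : MSOFormula Q)
  | imp (φ ψ : MSOFormula Q)
  | all₁ (x : ℕ) (φ : MSOFormula Q)
  | ex₁ (x : ℕ) (φ : MSOFormula Q)
  | all₂ (X : ℕ) (φ : MSOFormula Q)
  | ex₂ (X : ℕ) (φ : MSOFormula Q)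

namespace MSOFormula

/-- The free first-order variables of a formula. -/
def free₁ {Q : Type} : MSOFormula Q → Finset ℕ
  | eq s t => {s.variable, t.variable}
  | mem _ t => {t.variable}
  | color _ t => {t.variable}
  | not φ => φ.free₁
  | and φ ψ => φ.free₁ ∪ ψ.free₁
  | or φ ψ => φ.free₁ ∪ ψ.free₁
  | imp φ ψ => φ.free₁ ∪ ψ.free₁
  | all₁ x φ => φ.free₁.erase x
  | ex₁ x φ => φ.free₁.erase x
  | all₂ _ φ => φ.free₁
  | ex₂ _ φ => φ.free₁

/-- The free second-order variables of a formula. -/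
def free₂ {Q : Type} : MSOFormula Q → Finset ℕ
  | eq _ _ => ∅
  | mem X _ => {X}
  | color _ _ => ∅
  | not φ => φ.free₂
  | and φ ψ => φ.free₂ ∪ ψ.free₂
  | or φ ψ => φ.free₂ ∪ ψ.free₂
  | imp φ ψ => φ.free₂ ∪ ψ.free₂
  | all₁ _ φ => φ.free₂
  | ex₁ _ φ => φ.free₂
  | all₂ X φ => φ.free₂.erase X
  | ex₂ X φ => φ.free₂.erase X

/-- A formula is closed if no variable of either sort occurs free in it. -/
def IsClosed {Q : Type} (φ : MSOFormula Q) : Prop :=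
  φ.free₁ = ∅ ∧ φ.free₂ = ∅

/-- Satisfaction in (the structure of) a configuration `M`, where `v` interprets the first-order
variables by cells and `V` interprets the second-order variables by arbitrary sets of cells. -/
def Sat {Q : Type} (M : Configuration Q) :
    MSOFormula Q → (ℕ → ℤ × ℤ) → (ℕ → Set (ℤ × ℤ)) → Prop
  | eq s t, v, _ => s.value v = t.value v
  | mem X t, v, V => t.value v ∈ V X
  | color c t, v, _ => M (t.value v) = c
  | not φ, v, V => ¬ Sat M φ v V
  | and φ ψ, v, V => Sat M φ v V ∧ Sat M ψ v V
  | or φ ψ, v, V => Sat M φ v V ∨ Sat M ψ v V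
  | imp φ ψ, v, V => Sat M φ v V → Sat M ψ v V
  | all₁ x φ, v, V => ∀ z : ℤ × ℤ, Sat M φ (Function.update v x z) V
  | ex₁ x φ, v, V => ∃ z : ℤ × ℤ, Sat M φ (Function.update v x z) V
  | all₂ X φ, v, V => ∀ Z : Set (ℤ × ℤ), Sat M φ v (Function.update V X Z)
  | ex₂ X φ, v, V => ∃ Z : Set (ℤ × ℤ), Sat M φ v (Function.update V X Z)

/-- The set of configurations that satisfy `φ`. It is used for closed `φ` only, whose truth does
not depend on the assignments. -/
def models {Q : Type} (φ : MSOFormula Q) : Set (Configuration Q) :=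
  {M | ∀ v V, Sat M φ v V}

end MSOFormula

/-- A set of configurations is MSO-definable if it is the set of models of a closed formula. -/
def MSODefinable {Q : Type} (X : Set (Configuration Q)) : Prop :=
  ∃ φ : MSOFormula Q, φ.IsClosed ∧ X = φ.models

/-! ### Subshifts and forbidden languages

Finite patterns, their occurrences and `forbidden F` (the configurations in which no pattern of `F`
occurs) are Mathlib's. A Mathlib pattern is a finite partial configuration: a finite `support` with
the colours on it (off the support its `config` takes the default value and is never read). -/

/-- A subshift is a set of the form `X_F`, the set of configurations where no pattern of `F`
occurs. -/
def IsSubshift {Q : Type} [Inhabited Q] (X : Set (Configuration Q)) : Prop :=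
  ∃ F : Set (Pattern Q (ℤ × ℤ)), X = forbidden F

/-- The language of `X`: all finite patterns that occur in some configuration of `X`. -/
def patternLanguage {Q : Type} [Inhabited Q] (X : Set (Configuration Q)) :
    Set (Pattern Q (ℤ × ℤ)) :=
  {P | ∃ C ∈ X, ∃ z, P.occursInAt C z}

/-- The forbidden language of `X`: all finite patterns that occur in no configuration of `X`. -/
def forbiddenLanguage {Q : Type} [Inhabited Q] (X : Set (Configuration Q)) :
    Set (Pattern Q (ℤ × ℤ)) :=
  (patternLanguage X)ᶜ

/-! ### Patterns as inputs and outputs of algorithms -/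

/-- A list of coloured cells lists a pattern if no cell gets two colours. -/
def ListsPattern {q : ℕ} (l : List ((ℤ × ℤ) × Fin q)) : Prop :=
  ∀ a ∈ l, ∀ b ∈ l, a.1 = b.1 → a.2 = b.2

instance {q : ℕ} : DecidablePred (ListsPattern (q := q)) := fun l => by
  unfold ListsPattern; infer_instance

theorem primrecPred_listsPattern (q : ℕ) : PrimrecPred (ListsPattern (q := q)) := by
  have h : PrimrecRel fun (b a : (ℤ × ℤ) × Fin q) => a.1 = b.1 → a.2 = b.2 := by
    have h1 : PrimrecPred fun p : ((ℤ × ℤ) × Fin q) × ((ℤ × ℤ) × Fin q) => p.2.1 = p.1.1 :=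
      Primrec.eq.comp (Primrec.fst.comp Primrec.snd) (Primrec.fst.comp Primrec.fst)
    have h2 : PrimrecPred fun p : ((ℤ × ℤ) × Fin q) × ((ℤ × ℤ) × Fin q) => p.2.2 = p.1.2 :=
      Primrec.eq.comp (Primrec.snd.comp Primrec.snd) (Primrec.snd.comp Primrec.fst)
    exact (h1.not.or h2).of_eq fun p => imp_iff_not_or.symm
  have h3 : PrimrecRel fun (l : List ((ℤ × ℤ) × Fin q)) (a : (ℤ × ℤ) × Fin q) =>
      ∀ b ∈ l, a.1 = b.1 → a.2 = b.2 := h.forall_mem_list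
  have h4 : PrimrecRel fun (l m : List ((ℤ × ℤ) × Fin q)) =>
      ∀ a ∈ l, ∀ b ∈ m, a.1 = b.1 → a.2 = b.2 :=
    PrimrecRel.forall_mem_list
      (R := fun (a : (ℤ × ℤ) × Fin q) (m : List ((ℤ × ℤ) × Fin q)) =>
        ∀ b ∈ m, a.1 = b.1 → a.2 = b.2)
      (h3.comp Primrec.snd Primrec.fst)
  exact h4.comp Primrec.id Primrec.id

/-- Codes of finite patterns: finite lists of coloured cells in which no cell gets two colours. -/
def PatternCode (q : ℕ) : Type := {l : List ((ℤ × ℤ) × Fin q) // ListsPattern l}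

instance (q : ℕ) : Primcodable (PatternCode q) :=
  Primcodable.subtype (primrecPred_listsPattern q)

/-- The pattern with a given code: its support is the set of the listed cells, each of them with
its listed colour. -/
def PatternCode.toPattern {q : ℕ} (l : PatternCode (q + 1)) : Pattern (Fin (q + 1)) (ℤ × ℤ) where
  config z := (l.1.lookup z).getD default
  support := (l.1.map Prod.fst).toFinset
  condition z hz := by
    have : l.1.lookup z = none := by
      rw [List.lookup_eq_none_iff]
      intro p hp
      have hne : z ≠ p.1 := by
        rintro rfl
        exact hz (by simpa using ⟨p.2, hp⟩)
      simpa using hne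
    simp [this]

/-! ### Arithmetical sets -/

/-- `AlternatingPrefix R b n w` prefixes `n` alternating number quantifiers to `R`, beginning with
`∃` if `b = true` and with `∀` if `b = false`; the quantified variables are appended to the
arguments `w`, so that `AlternatingPrefix R true n [m]` says
`∃ x₁, ∀ x₂, ∃ x₃, …, R [m, x₁, …, xₙ]`. -/
def AlternatingPrefix (R : List ℕ → Prop) : Bool → ℕ → List ℕ → Prop
  | _, 0, w => R w
  | true, n + 1, w => ∃ x : ℕ, AlternatingPrefix R false n (w ++ [x])
  | false, n + 1, w => ∀ x : ℕ, AlternatingPrefix R true n (w ++ [x])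

/-- A set of natural numbers is arithmetical if it belongs to the arithmetical hierarchy: it is
defined by a finite alternating prefix of number quantifiers in front of a recursive relation. -/
def Arithmetical (E : Set ℕ) : Prop :=
  ∃ R : List ℕ → Prop, ComputablePred R ∧
    ∃ (b : Bool) (n : ℕ), ∀ m : ℕ, m ∈ E ↔ AlternatingPrefix R b n [m]

/-!
The subshift consists of the configurations over two colours in which no two cells of colour `1`
lie in a row at distance `m + 1` with `m ∈ E` (`distanceShift`). It is given by the forbidden
two-cell patterns `twoCells m` for `m ∈ E`, and for `m ∉ E` the configuration with exactly two such
cells at distance `m + 1` belongs to it. So `m ∈ E` if and only if `twoCells m` is in the forbidden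
language (`mem_forbiddenLanguage_distanceShift`).

It remains to see that monadic second-order logic over the plane can express, of two cells in a
row, that their distance belongs to an arithmetical set. Relative to a cell `o` chosen as origin,
the number `n` is the cell `n` steps to the east, and a set of cells represents a binary relation
on numbers through the coordinates `(i, j) ↦ (i, j - i)`: this cell lies on the column of the cell
of `i` and on the antidiagonal of the cell of `j`, and rays, hence lines, are definable as least
sets closed under a move (`MSOFormula.exists_sat_iff_mem_ray`). Monadic quantifiers over the plane therefore amount to quantifiers over numbers
and over binary relations on numbers (`ArithDefinable.exists_num`, `ArithDefinable.forall_rel`).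
Quantification over binary relations makes iteration definable (`ArithDefinable.leastIter`), hence
addition, multiplication and the pairing function, and by induction the graphs of all partial
recursive functions (`ArithDefinable.graph`). The quantifiers of an arithmetical definition become
quantifiers over numbers (`ArithDefinable.alternatingPrefix`). The formula obtained may be open;
its universal closure has the same models (`MSOFormula.msoDefinable_models`).
-/

open SymbolicDynamics.FullShift

/-! ### Universal closure of formulas -/

namespace MSOFormula

variable {Q : Type}

/-- Truth in all assignments is unaffected by universal quantification of first-order variables. -/
theorem exists_free₁_eq_empty (s : Finset ℕ) (φ : MSOFormula Q) (h : φ.free₁ ⊆ s) :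
    ∃ ψ : MSOFormula Q, ψ.free₁ = ∅ ∧ ψ.models = φ.models := by
  induction s using Finset.induction_on generalizing φ with
  | empty => exact ⟨φ, Finset.subset_empty.1 h, rfl⟩
  | insert x s _ ih =>
    obtain ⟨ψ, h₁, h₂⟩ := ih (all₁ x φ) (Finset.subset_insert_iff.1 h)
    refine ⟨ψ, h₁, h₂.trans ?_⟩
    ext M
    refine ⟨fun H v V => ?_, fun H v V z => H _ _⟩
    simpa using H v V (v x)

theorem exists_free₂_eq_empty (s : Finset ℕ) (φ : MSOFormula Q) (h : φ.free₂ ⊆ s) :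
    ∃ ψ : MSOFormula Q, ψ.free₁ = φ.free₁ ∧ ψ.free₂ = ∅ ∧ ψ.models = φ.models := by
  induction s using Finset.induction_on generalizing φ with
  | empty => exact ⟨φ, rfl, Finset.subset_empty.1 h, rfl⟩
  | insert X s _ ih =>
    obtain ⟨ψ, h₀, h₁, h₂⟩ := ih (all₂ X φ) (Finset.subset_insert_iff.1 h)
    refine ⟨ψ, h₀, h₁, h₂.trans ?_⟩
    ext M
    refine ⟨fun H v V => ?_, fun H v V Z => H _ _⟩
    simpa using H v V (V X)

/-- The models of an open formula, in the sense of truth under all assignments, are the models of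
its universal closure. -/
theorem msoDefinable_models (φ : MSOFormula Q) : MSODefinable φ.models := by
  obtain ⟨ψ, h₁, h₂⟩ := exists_free₁_eq_empty _ φ subset_rfl
  obtain ⟨χ, k₀, k₁, k₂⟩ := exists_free₂_eq_empty _ ψ subset_rfl
  exact ⟨χ, ⟨k₀.trans h₁, k₁⟩, (k₂.trans h₂).symm⟩

/-! ### Rays and lines in the plane -/

/-- The cells on the ray from `x` in a direction `d`, given by a term `τ` that moves the variable
`0` by `d`, form the least set that contains `x` and is closed under `τ`. -/
theorem exists_sat_iff_mem_ray {τ : MSOTerm} {d : ℤ × ℤ} (hτ : ∀ v, τ.value v = v 0 + d)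
    (x y : ℕ) : ∃ φ : MSOFormula Q, ∀ M v V, φ.Sat M v V ↔ ∃ n : ℕ, v y = v x + n • d := by
  refine ⟨all₂ 0 (imp (and (mem 0 (.var x)) (all₁ 0 (imp (mem 0 (.var 0)) (mem 0 τ))))
    (mem 0 (.var y))), fun M v V => ?_⟩
  simp only [Sat, MSOTerm.value, hτ, Function.update_self]
  constructor
  · intro h
    refine h {z | ∃ n : ℕ, z = v x + n • d} ⟨⟨0, by simp⟩, ?_⟩
    rintro _ ⟨n, rfl⟩
    exact ⟨n + 1, by rw [succ_nsmul, add_assoc]⟩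
  · rintro ⟨n, hn⟩ Z ⟨h₀, hs⟩
    rw [hn]
    clear hn
    induction n with
    | zero => simpa using h₀
    | succ n ih => rw [succ_nsmul, ← add_assoc]; exact hs _ ih

/-- The line through `x` in a direction `d` is the union of two opposite rays. -/
theorem exists_sat_iff_mem_line {τ τ' : MSOTerm} {d : ℤ × ℤ} (hτ : ∀ v, τ.value v = v 0 + d)
    (hτ' : ∀ v, τ'.value v = v 0 + -d) (x y : ℕ) :
    ∃ φ : MSOFormula Q, ∀ M v V, φ.Sat M v V ↔ ∃ t : ℤ, v y = v x + t • d := by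
  obtain ⟨φ, hφ⟩ := exists_sat_iff_mem_ray (Q := Q) hτ x y
  obtain ⟨ψ, hψ⟩ := exists_sat_iff_mem_ray (Q := Q) hτ' x y
  refine ⟨or φ ψ, fun M v V => ?_⟩
  simp only [Sat, hφ, hψ]
  constructor
  · rintro (⟨n, hn⟩ | ⟨n, hn⟩)
    · exact ⟨n, by simpa using hn⟩
    · exact ⟨-n, by simpa using hn⟩
  · rintro ⟨t, ht⟩
    obtain ⟨n, rfl | rfl⟩ := t.eq_nat_or_neg
    · exact .inl ⟨n, by simpa using ht⟩
    · exact .inr ⟨n, by simpa using ht⟩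

end MSOFormula

/-! ### Second-order arithmetic in the plane -/

/-- `ArithDefinable Q P`: the predicate `P` of `k` numbers and `m` binary relations on numbers is
expressed by a monadic second-order formula over the plane. With respect to an origin `o`, the
number `n` is represented by the cell `o + (n, 0)`, and a set `Z` of cells represents the relation
that holds of `i` and `j` if `Z` contains the cell `o + (i, j - i)`, where the column of `i` meets
the antidiagonal of `j`.

The formula is required for every choice of names for the variables, repetitions included, which
makes substitution of variables trivial and leaves fresh names for the bound variables. -/
def ArithDefinable (Q : Type) {k m : ℕ}
    (P : (Fin k → ℕ) → (Fin m → ℕ → ℕ → Prop) → Prop) : Prop :=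
  ∀ (o : ℕ) (x : Fin k → ℕ) (y : Fin m → ℕ), ∃ φ : MSOFormula Q,
    ∀ (M : Configuration Q) (v : ℕ → ℤ × ℤ) (V : ℕ → Set (ℤ × ℤ)) (a : Fin k → ℕ),
      (∀ i, v (x i) = v o + ((a i : ℤ), 0)) →
        (φ.Sat M v V ↔ P a fun j r s => v o + ((r : ℤ), (s : ℤ) - r) ∈ V (y j))

namespace ArithDefinable

variable {Q : Type} {k m : ℕ} {P R : (Fin k → ℕ) → (Fin m → ℕ → ℕ → Prop) → Prop}

theorem of_iff (h : ArithDefinable Q P) (H : ∀ a A, R a A ↔ P a A) : ArithDefinable Q R := by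
  rwa [show R = P from funext₂ fun a A => propext (H a A)]

theorem not (h : ArithDefinable Q P) : ArithDefinable Q fun a A => ¬ P a A := fun o x y => by
  obtain ⟨φ, hφ⟩ := h o x y
  exact ⟨.not φ, fun M v V a ha => not_congr (hφ M v V a ha)⟩

theorem and (h : ArithDefinable Q P) (h' : ArithDefinable Q R) :
    ArithDefinable Q fun a A => P a A ∧ R a A := fun o x y => by
  obtain ⟨φ, hφ⟩ := h o x y
  obtain ⟨ψ, hψ⟩ := h' o x y
  exact ⟨.and φ ψ, fun M v V a ha => and_congr (hφ M v V a ha) (hψ M v V a ha)⟩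

theorem or (h : ArithDefinable Q P) (h' : ArithDefinable Q R) :
    ArithDefinable Q fun a A => P a A ∨ R a A := fun o x y => by
  obtain ⟨φ, hφ⟩ := h o x y
  obtain ⟨ψ, hψ⟩ := h' o x y
  exact ⟨.or φ ψ, fun M v V a ha => or_congr (hφ M v V a ha) (hψ M v V a ha)⟩

theorem imp (h : ArithDefinable Q P) (h' : ArithDefinable Q R) :
    ArithDefinable Q fun a A => P a A → R a A := fun o x y => by
  obtain ⟨φ, hφ⟩ := h o x y
  obtain ⟨ψ, hψ⟩ := h' o x y
  exact ⟨.imp φ ψ, fun M v V a ha => imp_congr (hφ M v V a ha) (hψ M v V a ha)⟩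

theorem exists_num {P : ℕ → (Fin k → ℕ) → (Fin m → ℕ → ℕ → Prop) → Prop}
    (h : ArithDefinable Q fun (a : Fin (k + 1) → ℕ) A => P (a 0) (Fin.tail a) A) :
    ArithDefinable Q fun a A => ∃ n, P n a A := fun o x y => by
  obtain ⟨c, hc⟩ := Infinite.exists_notMem_finset (insert o (Finset.univ.image x))
  simp only [Finset.mem_insert, Finset.mem_image, Finset.mem_univ, true_and, not_or,
    not_exists] at hc
  obtain ⟨φ, hφ⟩ := h o (Fin.cons c x) y
  -- the numbers are the cells of the eastward ray from the origin
  obtain ⟨ρ, hρ⟩ := MSOFormula.exists_sat_iff_mem_ray (Q := Q) (τ := .app .east (.var 0))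
    (d := (1, 0)) (fun v => by simp [MSOTerm.value, Direction.move, Prod.ext_iff]) o c
  refine ⟨.ex₁ c (.and ρ φ), fun M v V a ha => ?_⟩
  have key (n : ℕ) : φ.Sat M (Function.update v c (v o + ((n : ℤ), 0))) V ↔
      P n a fun j r s => v o + ((r : ℤ), (s : ℤ) - r) ∈ V (y j) := by
    have := hφ M (Function.update v c (v o + ((n : ℤ), 0))) V (Fin.cons n a) (by
      intro i
      rw [Function.update_of_ne (Ne.symm hc.1)]
      refine Fin.cases ?_ (fun i => ?_) i
      · simp
      · simpa [Function.update_of_ne (hc.2 i)] using ha i)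
    rwa [Function.update_of_ne (Ne.symm hc.1)] at this
  simp only [MSOFormula.Sat, hρ, Function.update_self, Function.update_of_ne (Ne.symm hc.1)]
  constructor
  · rintro ⟨z, ⟨n, rfl⟩, hz⟩
    exact ⟨n, (key n).1 (by simpa using hz)⟩
  · rintro ⟨n, hn⟩
    exact ⟨_, ⟨n, by simp⟩, (key n).2 hn⟩

theorem forall_num {P : ℕ → (Fin k → ℕ) → (Fin m → ℕ → ℕ → Prop) → Prop}
    (h : ArithDefinable Q fun (a : Fin (k + 1) → ℕ) A => P (a 0) (Fin.tail a) A) :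
    ArithDefinable Q fun a A => ∀ n, P n a A :=
  (exists_num (P := fun n a A => ¬ P n a A) h.not).not.of_iff fun a A => by simp

theorem forall_rel {P : (ℕ → ℕ → Prop) → (Fin k → ℕ) → (Fin m → ℕ → ℕ → Prop) → Prop}
    (h : ArithDefinable Q fun a (A : Fin (m + 1) → ℕ → ℕ → Prop) => P (A 0) a (Fin.tail A)) :
    ArithDefinable Q fun a A => ∀ Z, P Z a A := fun o x y => by
  obtain ⟨c, hc⟩ := Infinite.exists_notMem_finset (Finset.univ.image y)
  simp only [Finset.mem_image, Finset.mem_univ, true_and, not_exists] at hc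
  obtain ⟨φ, hφ⟩ := h o x (Fin.cons c y)
  refine ⟨.all₂ c φ, fun M v V a ha => ?_⟩
  have key (Z : Set (ℤ × ℤ)) : φ.Sat M v (Function.update V c Z) ↔
      P (fun r s => v o + ((r : ℤ), (s : ℤ) - r) ∈ Z) a
        fun j r s => v o + ((r : ℤ), (s : ℤ) - r) ∈ V (y j) := by
    rw [hφ M v _ a ha]
    simp +unfoldPartialApp [Fin.tail, Function.update_of_ne (hc _)]
  simp only [MSOFormula.Sat, key]
  refine ⟨fun H Z => ?_, fun H Z => H _⟩
  -- every relation is represented by some set of cells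
  convert H {z | ∃ r s : ℕ, z = v o + ((r : ℤ), (s : ℤ) - r) ∧ Z r s} using 1
  ext r s
  refine ⟨fun hZ => ⟨r, s, rfl, hZ⟩, ?_⟩
  rintro ⟨r', s', he, hZ⟩
  simp only [add_right_inj, Prod.mk.injEq, Nat.cast_inj] at he
  obtain ⟨rfl, he⟩ := he
  obtain rfl : s = s' := by omega
  exact hZ

theorem eq_var (i j : Fin k) :
    ArithDefinable Q fun a (_ : Fin m → ℕ → ℕ → Prop) => a i = a j := fun o x y =>
  ⟨.eq (.var (x i)) (.var (x j)), fun M v V a ha => by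
    simp [MSOFormula.Sat, MSOTerm.value, ha]⟩

theorem succ_var (i j : Fin k) :
    ArithDefinable Q fun a (_ : Fin m → ℕ → ℕ → Prop) => a i + 1 = a j := fun o x y =>
  ⟨.eq (.app .east (.var (x i))) (.var (x j)), fun M v V a ha => by
    simp [MSOFormula.Sat, MSOTerm.value, ha, Direction.move, Prod.ext_iff, add_assoc]
    omega⟩

theorem zero_var (i : Fin k) :
    ArithDefinable Q fun a (_ : Fin m → ℕ → ℕ → Prop) => a i = 0 := fun o x y =>
  ⟨.eq (.var (x i)) (.var o), fun M v V a ha => by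
    simp [MSOFormula.Sat, MSOTerm.value, ha]⟩

theorem rel_var (l : Fin m) (i j : Fin k) :
    ArithDefinable Q fun a (A : Fin m → ℕ → ℕ → Prop) => A l (a i) (a j) := fun o x y => by
  obtain ⟨c, hc⟩ := Infinite.exists_notMem_finset ({x i, x j} : Finset ℕ)
  simp only [Finset.mem_insert, Finset.mem_singleton, not_or] at hc
  obtain ⟨φ, hφ⟩ := MSOFormula.exists_sat_iff_mem_line (Q := Q) (τ := .app .north (.var 0))
    (τ' := .app .south (.var 0)) (d := (0, 1))
    (fun v => by simp [MSOTerm.value, Direction.move, Prod.ext_iff])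
    (fun v => by simp [MSOTerm.value, Direction.move, Prod.ext_iff, sub_eq_add_neg]) (x i) c
  obtain ⟨ψ, hψ⟩ := MSOFormula.exists_sat_iff_mem_line (Q := Q)
    (τ := .app .north (.app .west (.var 0))) (τ' := .app .south (.app .east (.var 0)))
    (d := (-1, 1))
    (fun v => by simp [MSOTerm.value, Direction.move, Prod.ext_iff, sub_eq_add_neg])
    (fun v => by simp [MSOTerm.value, Direction.move, Prod.ext_iff, sub_eq_add_neg]) (x j) c
  refine ⟨.ex₁ c (.and φ (.and ψ (.mem (y l) (.var c)))), fun M v V a ha => ?_⟩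
  simp only [MSOFormula.Sat, MSOTerm.value, hφ, hψ, Function.update_self,
    Function.update_of_ne (Ne.symm hc.1), Function.update_of_ne (Ne.symm hc.2), ha]
  constructor
  · rintro ⟨z, ⟨t, rfl⟩, ⟨u, hu⟩, hz⟩
    simp only [add_assoc, add_right_inj, Prod.ext_iff, Prod.fst_add, Prod.snd_add, Prod.smul_fst,
      Prod.smul_snd, smul_eq_mul] at hu
    obtain rfl : t = (a j : ℤ) - a i := by linarith [hu.1, hu.2]
    simpa [add_assoc] using hz
  · intro hz
    refine ⟨_, ⟨(a j : ℤ) - a i, rfl⟩, ⟨(a j : ℤ) - a i, ?_⟩, ?_⟩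
    · simp [Prod.ext_iff]
    · simpa [add_assoc] using hz

end ArithDefinable

/-! ### Iteration and arithmetic operations -/

/-- The least relation `Z` with `Z 0 u` for all `u` satisfying `B`, and with `Z (i + 1) w` whenever
`Z i u` and `S i u w`, holds of `n` and `b`. -/
def LeastIter (B : ℕ → Prop) (S : ℕ → ℕ → ℕ → Prop) (n b : ℕ) : Prop :=
  ∀ Z : ℕ → ℕ → Prop, (∀ z, z = 0 → ∀ u, B u → Z z u) →
    (∀ i j, i + 1 = j → ∀ u, Z i u → ∀ w, S i u w → Z j w) → Z n b

theorem leastIter_iff {B : ℕ → Prop} {S : ℕ → ℕ → ℕ → Prop} {T : ℕ → ℕ → Prop}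
    (h₀ : ∀ u, T 0 u ↔ B u) (hs : ∀ i w, T (i + 1) w ↔ ∃ u, T i u ∧ S i u w) (n b : ℕ) :
    LeastIter B S n b ↔ T n b := by
  constructor
  · intro h
    refine h T ?_ ?_
    · rintro _ rfl u hu
      exact (h₀ u).2 hu
    · rintro i _ rfl u hu w hw
      exact (hs i w).2 ⟨u, hu, hw⟩
  · intro h Z hZ₀ hZs
    induction n generalizing b with
    | zero => exact hZ₀ 0 rfl b ((h₀ b).1 h)
    | succ n ih =>
      obtain ⟨u, hu, hw⟩ := (hs n b).1 h
      exact hZs n _ rfl u (ih u hu) b hw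

namespace ArithDefinable

variable {Q : Type} {k k' m : ℕ}

theorem comp {P : (Fin k → ℕ) → Prop}
    (h : ArithDefinable Q fun a (_ : Fin 0 → ℕ → ℕ → Prop) => P a) (σ : Fin k → Fin k') :
    ArithDefinable Q fun a (_ : Fin m → ℕ → ℕ → Prop) => P (a ∘ σ) := fun o x _ => by
  obtain ⟨φ, hφ⟩ := h o (x ∘ σ) Fin.elim0
  exact ⟨φ, fun M v V a ha => hφ M v V (a ∘ σ) fun i => ha (σ i)⟩

theorem leastIter {B : ℕ → (Fin k → ℕ) → Prop} {S : ℕ → ℕ → ℕ → (Fin k → ℕ) → Prop}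
    (hB : ArithDefinable Q fun (a : Fin (k + 1) → ℕ) (_ : Fin 0 → ℕ → ℕ → Prop) =>
      B (a 0) (Fin.tail a))
    (hS : ArithDefinable Q fun (a : Fin (k + 3) → ℕ) (_ : Fin 0 → ℕ → ℕ → Prop) =>
      S (a 0) (a 1) (a 2) (Fin.tail (Fin.tail (Fin.tail a)))) (i j : Fin k) :
    ArithDefinable Q fun a (_ : Fin 0 → ℕ → ℕ → Prop) =>
      LeastIter (fun u => B u a) (fun i u w => S i u w a) (a i) (a j) := by
  refine forall_rel (imp (forall_num (imp (zero_var 0) (forall_num (imp ?_ (rel_var 0 1 0)))))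
    (imp (forall_num (forall_num (imp (succ_var 1 0) (forall_num (imp (rel_var 0 2 0)
      (forall_num (imp ?_ (rel_var 0 2 0)))))))) (rel_var 0 i j)))
  · exact hB.comp (Fin.cons 0 fun l => l.succ.succ)
  · exact hS.comp (Fin.cons 3 (Fin.cons 1 (Fin.cons 0 fun l => l.succ.succ.succ.succ)))

theorem add_eq : ArithDefinable Q fun (a : Fin 3 → ℕ) (_ : Fin 0 → ℕ → ℕ → Prop) =>
    a 0 + a 1 = a 2 := by
  refine (leastIter (B := fun u a => u = a 0) (S := fun _ u w _ => u + 1 = w)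
    (eq_var 0 1) (succ_var 1 2) 1 2).of_iff fun a _ => ?_
  exact (leastIter_iff (T := fun n b => a 0 + n = b) (fun u => by simp [eq_comm])
    (fun i w => by simp [add_assoc]) _ _).symm

theorem mul_eq : ArithDefinable Q fun (a : Fin 3 → ℕ) (_ : Fin 0 → ℕ → ℕ → Prop) =>
    a 0 * a 1 = a 2 := by
  refine (leastIter (B := fun u _ => u = 0) (S := fun _ u w a => u + a 0 = w)
    (zero_var 0) (add_eq.comp ![1, 3, 2]) 1 2).of_iff fun a _ => ?_
  exact (leastIter_iff (T := fun n b => a 0 * n = b) (fun u => by simp [eq_comm])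
    (fun i w => by simp [mul_add]) _ _).symm

theorem lt : ArithDefinable Q fun (a : Fin 2 → ℕ) (_ : Fin 0 → ℕ → ℕ → Prop) => a 0 < a 1 := by
  refine (exists_num (exists_num (and (add_eq.comp ![2, 1, 0]) (succ_var 0 3))) :
    ArithDefinable Q fun (a : Fin 2 → ℕ) (_ : Fin 0 → ℕ → ℕ → Prop) =>
      ∃ d e, a 0 + d = e ∧ e + 1 = a 1).of_iff fun a _ => ?_
  simp only [exists_eq_left', Nat.lt_iff_add_one_le, le_iff_exists_add]
  exact exists_congr fun d => by omega

theorem pair_eq : ArithDefinable Q fun (a : Fin 3 → ℕ) (_ : Fin 0 → ℕ → ℕ → Prop) =>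
    Nat.pair (a 0) (a 1) = a 2 := by
  refine (or (and (lt.comp ![0, 1])
      (exists_num (and (mul_eq.comp ![2, 2, 0]) (add_eq.comp ![0, 1, 3]))))
    (and (lt.comp ![0, 1]).not (exists_num (exists_num (and (mul_eq.comp ![2, 2, 1])
      (and (add_eq.comp ![1, 2, 0]) (add_eq.comp ![0, 3, 4])))))) :
    ArithDefinable Q fun (a : Fin 3 → ℕ) (_ : Fin 0 → ℕ → ℕ → Prop) =>
      (a 0 < a 1 ∧ ∃ u, a 1 * a 1 = u ∧ u + a 0 = a 2) ∨
        (¬ a 0 < a 1 ∧ ∃ u w, a 0 * a 0 = u ∧ u + a 0 = w ∧ w + a 1 = a 2)).of_iff fun a _ => ?_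
  by_cases h : a 0 < a 1 <;> simp [Nat.pair, h]

/-! ### Computable functions and arithmetical sets -/

/-- The graph of a partial recursive function is definable. Primitive recursion is the iteration
of a definable step; all other clauses are first-order. -/
theorem graph {f : ℕ →. ℕ} (hf : Nat.Partrec f) :
    ArithDefinable Q fun (a : Fin 2 → ℕ) (_ : Fin 0 → ℕ → ℕ → Prop) => a 1 ∈ f (a 0) := by
  induction hf with
  | zero => exact (zero_var 1).of_iff fun a _ => by simp [pure, PFun.pure]
  | succ => exact (succ_var 0 1).of_iff fun a _ => by simp [eq_comm]
  | left =>
    refine (exists_num (pair_eq.comp ![2, 0, 1]) :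
      ArithDefinable Q fun (a : Fin 2 → ℕ) (_ : Fin 0 → ℕ → ℕ → Prop) =>
        ∃ y, Nat.pair (a 1) y = a 0).of_iff fun a _ => ?_
    simp only [PFun.coe_val, Part.mem_some_iff]
    exact ⟨fun h => ⟨(a 0).unpair.2, by rw [h, Nat.pair_unpair]⟩, fun ⟨y, h⟩ => by simp [← h]⟩
  | right =>
    refine (exists_num (pair_eq.comp ![0, 2, 1]) :
      ArithDefinable Q fun (a : Fin 2 → ℕ) (_ : Fin 0 → ℕ → ℕ → Prop) =>
        ∃ y, Nat.pair y (a 1) = a 0).of_iff fun a _ => ?_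
    simp only [PFun.coe_val, Part.mem_some_iff]
    exact ⟨fun h => ⟨(a 0).unpair.1, by rw [h, Nat.pair_unpair]⟩, fun ⟨y, h⟩ => by simp [← h]⟩
  | @pair f g _ _ hf hg =>
    refine (exists_num (exists_num (and (hf.comp ![2, 1]) (and (hg.comp ![2, 0])
      (pair_eq.comp ![1, 0, 3])))) :
      ArithDefinable Q fun (a : Fin 2 → ℕ) (_ : Fin 0 → ℕ → ℕ → Prop) =>
        ∃ u w, u ∈ f (a 0) ∧ w ∈ g (a 0) ∧ Nat.pair u w = a 1).of_iff fun a _ => ?_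
    simp [Seq.seq]
  | @comp f g _ _ hf hg =>
    refine (exists_num (and (hg.comp ![1, 0]) (hf.comp ![0, 2])) :
      ArithDefinable Q fun (a : Fin 2 → ℕ) (_ : Fin 0 → ℕ → ℕ → Prop) =>
        ∃ u, u ∈ g (a 0) ∧ a 1 ∈ f u).of_iff fun a _ => ?_
    exact Part.mem_bind_iff
  | @prec f g _ _ hf hg =>
    have step : ArithDefinable Q fun (a : Fin 4 → ℕ) (_ : Fin 0 → ℕ → ℕ → Prop) =>
        ∃ p q, Nat.pair (a 0) (a 1) = p ∧ Nat.pair (a 3) p = q ∧ a 2 ∈ g q :=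
      exists_num (exists_num (and (pair_eq.comp ![2, 3, 1]) (and (pair_eq.comp ![5, 1, 0])
        (hg.comp ![0, 4]))))
    have iter := leastIter (k := 3) (B := fun u a => u ∈ f (a 0))
      (S := fun i u w a => ∃ p q, Nat.pair i u = p ∧ Nat.pair (a 0) p = q ∧ w ∈ g q)
      (hf.comp ![1, 0]) (step.comp ![0, 1, 2, 3]) 1 2
    refine (exists_num (exists_num (and (pair_eq.comp ![1, 0, 2]) (iter.comp ![1, 0, 3]))) :
      ArithDefinable Q fun (a : Fin 2 → ℕ) (_ : Fin 0 → ℕ → ℕ → Prop) =>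
        ∃ x n, Nat.pair x n = a 0 ∧ LeastIter (fun u => u ∈ f x) (fun i u w =>
          ∃ p q, Nat.pair i u = p ∧ Nat.pair x p = q ∧ w ∈ g q) n (a 1)).of_iff fun a _ => ?_
    have key (x n b : ℕ) := leastIter_iff (B := fun u => u ∈ f x)
      (S := fun i u w => ∃ p q, Nat.pair i u = p ∧ Nat.pair x p = q ∧ w ∈ g q)
      (T := fun n b => b ∈ (n.rec (f x) fun y IH => do
        let i ← IH; g (Nat.pair x (Nat.pair y i)) : Part ℕ))
      (fun u => Iff.rfl) (fun i w => by simp) n b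
    simp only [key, Nat.unpaired]
    constructor
    · intro h
      exact ⟨_, _, Nat.pair_unpair _, h⟩
    · rintro ⟨x, n, hp, h⟩
      simpa [← hp] using h
  | @rfind f _ hf =>
    refine (and (exists_num (exists_num (and (pair_eq.comp ![2, 3, 1]) (and (zero_var 0)
      (hf.comp ![1, 0]))))) (forall_num (imp (lt.comp ![0, 2]) (exists_num (exists_num
        (and (pair_eq.comp ![3, 2, 1]) (and (zero_var 0).not (hf.comp ![1, 0]))))))) :
      ArithDefinable Q fun (a : Fin 2 → ℕ) (_ : Fin 0 → ℕ → ℕ → Prop) =>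
        (∃ p z, Nat.pair (a 0) (a 1) = p ∧ z = 0 ∧ z ∈ f p) ∧
          ∀ n, n < a 1 → ∃ p z, Nat.pair (a 0) n = p ∧ ¬ z = 0 ∧ z ∈ f p).of_iff fun a _ => ?_
    have key (n : ℕ) : false ∈ (fun m => decide (m = 0)) <$> f (Nat.pair (a 0) n) ↔
        ∃ p z, Nat.pair (a 0) n = p ∧ ¬ z = 0 ∧ z ∈ f p := by
      simp only [Part.map_eq_map, Part.mem_map_iff, decide_eq_false_iff_not, exists_and_left,
        exists_eq_left']
      simp only [and_comm]
    refine Nat.mem_rfind.trans (and_congr (by simp) ?_)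
    exact ⟨fun h n hn => (key n).1 (h hn), fun h n hn => (key n).2 (h n hn)⟩

theorem of_computable {f : ℕ → ℕ} (hf : Computable f) :
    ArithDefinable Q fun (a : Fin 2 → ℕ) (_ : Fin 0 → ℕ → ℕ → Prop) => f (a 0) = a 1 :=
  (graph (Partrec.nat_iff.1 hf)).of_iff fun a _ => by simp [eq_comm]

open Encodable Denumerable in
/-- Lists are represented by their codes, so that appending a quantified variable is a computable
function of the code and of the variable. -/
theorem alternatingPrefix {R : List ℕ → Prop} (hR : ComputablePred R) (b : Bool) (n : ℕ) :
    ArithDefinable Q fun (a : Fin 1 → ℕ) (_ : Fin 0 → ℕ → ℕ → Prop) =>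
      AlternatingPrefix R b n (ofNat (List ℕ) (a 0)) := by
  induction n generalizing b with
  | zero =>
    obtain ⟨_, hR⟩ := hR
    have hc : Computable fun c : ℕ => encode (decide (R (ofNat (List ℕ) c))) :=
      Computable.encode.comp (hR.comp (Computable.ofNat _))
    -- the code of `true` is `1`
    refine (exists_num (exists_num (and (zero_var 0) (and (succ_var 0 1)
      ((of_computable hc).comp ![2, 1])))) :
      ArithDefinable Q fun (a : Fin 1 → ℕ) (_ : Fin 0 → ℕ → ℕ → Prop) =>
        ∃ u z, z = 0 ∧ z + 1 = u ∧ encode (decide (R (ofNat (List ℕ) (a 0)))) = u).of_iff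
      fun a _ => ?_
    by_cases h : R (ofNat (List ℕ) (a 0)) <;> simp [AlternatingPrefix, h]
  | succ n ih =>
    have hc : Computable fun p : ℕ =>
        encode (ofNat (List ℕ) p.unpair.1 ++ [p.unpair.2]) := by
      refine Primrec.to_comp (Primrec.encode.comp (Primrec.list_concat.comp
        ((Primrec.ofNat _).comp (Primrec.fst.comp Primrec.unpair))
        (Primrec.snd.comp Primrec.unpair)))
    have step (b : Bool) : ArithDefinable Q
        fun (a : Fin 2 → ℕ) (_ : Fin 0 → ℕ → ℕ → Prop) =>
          AlternatingPrefix R b n (ofNat (List ℕ) (a 1) ++ [a 0]) := by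
      refine (exists_num (exists_num (and (pair_eq.comp ![3, 2, 1])
        (and ((of_computable hc).comp ![1, 0]) ((ih b).comp ![0])))) :
        ArithDefinable Q fun (a : Fin 2 → ℕ) (_ : Fin 0 → ℕ → ℕ → Prop) =>
          ∃ p c, Nat.pair (a 1) (a 0) = p ∧
            encode (ofNat (List ℕ) p.unpair.1 ++ [p.unpair.2]) = c ∧
              AlternatingPrefix R b n (ofNat (List ℕ) c)).of_iff fun a _ => ?_
      simp
    cases b
    · exact forall_num (step true)
    · exact exists_num (step false)

open Encodable Denumerable in
theorem of_arithmetical {E : Set ℕ} (hE : Arithmetical E) :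
    ArithDefinable Q fun (a : Fin 1 → ℕ) (_ : Fin 0 → ℕ → ℕ → Prop) => a 0 ∈ E := by
  obtain ⟨R, hR, b, n, hE⟩ := hE
  have hc : Computable fun m : ℕ => encode [m] :=
    Primrec.to_comp (Primrec.encode.comp
      (Primrec.list_cons.comp Primrec.id (Primrec.const [])))
  refine (exists_num (and ((of_computable hc).comp ![1, 0])
    ((alternatingPrefix hR b n).comp ![0])) :
    ArithDefinable Q fun (a : Fin 1 → ℕ) (_ : Fin 0 → ℕ → ℕ → Prop) =>
      ∃ c, encode [a 0] = c ∧ AlternatingPrefix R b n (ofNat (List ℕ) c)).of_iff fun a _ => ?_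
  rw [hE]
  simp only [exists_eq_left', ofNat_encode]

end ArithDefinable

/-! ### The subshift of forbidden distances -/

/-- The code of the pattern that consists of two cells of colour `1` in a row, at distance
`m + 1`. -/
def twoCells (m : ℕ) : PatternCode 2 :=
  ⟨[(((0 : ℤ), (0 : ℤ)), 1), (((m : ℤ) + 1, (0 : ℤ)), 1)], by simp [ListsPattern]⟩

theorem computable_twoCells : Computable twoCells := by
  -- the code of a nonnegative integer is twice the number
  have hint : Primrec fun m : ℕ => (m : ℤ) + 1 := by
    have : Primrec fun m : ℕ => 2 * (m + 1) :=
      Primrec.nat_mul.comp (Primrec.const 2) Primrec.succ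
    exact Primrec.encode_iff.1 (this.of_eq fun m => rfl)
  have hlist : Primrec fun m : ℕ =>
      [(((0 : ℤ), (0 : ℤ)), (1 : Fin 2)), (((m : ℤ) + 1, (0 : ℤ)), (1 : Fin 2))] :=
    Primrec.list_cons.comp (Primrec.const _) (Primrec.list_cons.comp
      ((hint.pair (Primrec.const 0)).pair (Primrec.const 1)) (Primrec.const []))
  exact Primrec.to_comp (Primrec.subtype_val_iff (hp := primrecPred_listsPattern 2).1 hlist)

theorem occursInAt_twoCells (m : ℕ) (C : Configuration (Fin 2)) (z : ℤ × ℤ) :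
    (twoCells m).toPattern.occursInAt C z ↔ C z = 1 ∧ C (z + ((m : ℤ) + 1, 0)) = 1 := by
  have h₀ : z + ((0 : ℤ), (0 : ℤ)) = z := add_zero z
  simp only [Pattern.occursInAt, PatternCode.toPattern, twoCells, List.map_cons, List.map_nil,
    List.mem_toFinset, List.mem_cons, List.not_mem_nil, or_false, forall_eq_or_imp, forall_eq,
    List.lookup, BEq.rfl, Option.getD_some, h₀]
  -- whether or not the lookup passes over the first cell, it finds the colour `1`
  cases ((m : ℤ) + 1, (0 : ℤ)) == (0, 0) <;> rfl

/-- The configurations over two colours in which no two cells of colour `1` lie in a row at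
distance `m + 1` for any `m ∈ E`. -/
def distanceShift (E : Set ℕ) : Set (Configuration (Fin 2)) :=
  forbidden {P | ∃ m ∈ E, P = (twoCells m).toPattern}

theorem mem_distanceShift {E : Set ℕ} {C : Configuration (Fin 2)} :
    C ∈ distanceShift E ↔
      ∀ m ∈ E, ∀ z, ¬ (C z = 1 ∧ C (z + ((m : ℤ) + 1, 0)) = 1) := by
  simp only [distanceShift, forbidden, Set.mem_ofPred_eq, forall_exists_index, and_imp]
  constructor
  · intro h m hm z hz
    exact h _ m hm rfl z ((occursInAt_twoCells m C z).2 hz)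
  · rintro h _ m hm rfl z hz
    exact h m hm z ((occursInAt_twoCells m C z).1 hz)

/-- If `m ∉ E`, the configuration with exactly two cells of colour `1`, placed in a row at distance
`m + 1`, belongs to the subshift: no other distance occurs in it. -/
theorem mem_forbiddenLanguage_distanceShift (E : Set ℕ) (m : ℕ) :
    (twoCells m).toPattern ∈ forbiddenLanguage (distanceShift E) ↔ m ∈ E := by
  simp only [forbiddenLanguage, patternLanguage, Set.mem_compl_iff, Set.mem_ofPred_eq,
    occursInAt_twoCells, not_exists, not_and]
  constructor
  · intro h
    by_contra hm
    refine h (fun z => if z = (0, 0) ∨ z = ((m : ℤ) + 1, 0) then 1 else 0) ?_ (0, 0)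
      (by simp) (by simp)
    rw [mem_distanceShift]
    rintro k hk ⟨z₁, z₂⟩ ⟨h₁, h₂⟩
    have hkm : k ≠ m := fun h => hm (h ▸ hk)
    simp at h₁ h₂
    omega
  · intro hm C hC z h₁ h₂
    exact mem_distanceShift.1 hC m hm z ⟨h₁, h₂⟩

theorem msoDefinable_distanceShift {E : Set ℕ} (hE : Arithmetical E) :
    MSODefinable (distanceShift E) := by
  have hE' : ArithDefinable (Fin 2) fun (a : Fin 1 → ℕ) (_ : Fin 0 → ℕ → ℕ → Prop) => a 0 ∈ E :=
    .of_arithmetical hE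
  -- the variable `0` names the origin, and the variable `1` the cell of the number `m`
  obtain ⟨φ, hφ⟩ := hE' 0 (fun _ => 1) Fin.elim0
  obtain ⟨ρ, hρ⟩ := MSOFormula.exists_sat_iff_mem_ray (Q := Fin 2) (τ := .app .east (.var 0))
    (d := (1, 0)) (fun v => by simp [MSOTerm.value, Direction.move, Prod.ext_iff]) 0 1
  convert MSOFormula.msoDefinable_models (.imp (.and ρ φ)
    (.not (.and (.color 1 (.var 0)) (.color 1 (.app .east (.var 1))))))
  ext C
  simp only [mem_distanceShift, MSOFormula.models, MSOFormula.Sat, MSOTerm.value,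
    Set.mem_ofPred_eq, hρ]
  constructor
  · rintro h v V ⟨⟨m, hm⟩, hφ'⟩
    have hm' : v 1 = v 0 + ((m : ℤ), 0) := by simpa using hm
    have hmE : m ∈ E := (hφ C v V (fun _ => m) fun _ => hm').1 hφ'
    have := h m hmE (v 0)
    simpa [hm', Direction.move, Prod.add_def, add_assoc] using this
  · intro h m hm z
    let v : ℕ → ℤ × ℤ := fun i => if i = 0 then z else z + ((m : ℤ), 0)
    have := h v (fun _ => ∅) ⟨⟨m, by simp [v]⟩,
      (hφ C v _ (fun _ => m) fun _ => by simp [v]).2 hm⟩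
    simpa [v, Direction.move, Prod.add_def, add_assoc] using this

theorem mainTheorem4 (E : Set ℕ) (hE : Arithmetical E) :
    ∃ (q : ℕ) (X : Set (Configuration (Fin (q + 1)))),
      MSODefinable X ∧ IsSubshift X ∧
        ManyOneReducible (fun m : ℕ => m ∈ E)
          (fun l : PatternCode (q + 1) => l.toPattern ∈ forbiddenLanguage X) :=
  ⟨1, distanceShift E, msoDefinable_distanceShift hE, ⟨_, rfl⟩, twoCells, computable_twoCells,
    fun m => (mem_forbiddenLanguage_distanceShift E m).symm⟩
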